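/- **Proposition ($\mathrm J$-Ando–Hiai inequality).** Let $\mathbb D\in\{\mathbb R,\mathbb C,\mathbb H\}$, let $p,q\ge 0$ be integers, $n=p+q$, and $\mathrm J=\mathrm{diag}(\mathrm{Id}_p,-\mathrm{Id}_q)\in \mathrm{Mat}(n\times n,\mathbb D)$. Write $X^*=\overline{X}^{\,t}$ and $X\bullet Y=X\mathrm JY$. Let $$\mathfrak p_{\mathrm J}=\{X\in\mathrm{Mat}(n\times n,\mathbb D): \mathrm JX^*\mathrm J=X\},\qquad \mathscr P_{\mathrm J}=\{X\in\mathfrak p_{\mathrm J}: \mathrm JX \text{ is positive definite Hermitian}\}.$$ Let $\exp_{\mathrm J}(X)=\mathrm J\exp(\mathrm JX)$, which is a bijection $\mathfrak p_{\mathrm J}\to\mathscr P_{\mathrm J}$, and let $\log_{\mathrm J}:\mathscr P_{\mathrm J}\to\mathfrak p_{\mathrm J}$ be its inverse. For $X\in\mathscr P_{\mathrm J}$ and $s\in\mathbb R$ put $X^s_{\mathrm J}=\exp_{\mathrm J}(s\log_{\mathrm J}X)$. For $A,B\in\mathscr P_{\mathrm J}$ and $t\in[0,1]$ put $$A\,\sharp^{\mathrm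 J}_t B=A^{1/2}_{\mathrm J}\bullet\bigl(A^{-1/2}_{\mathrm J}\bullet B\bullet A^{-1/2}_{\mathrm J}\bigr)^t_{\mathrm J}\bullet A^{1/2}_{\mathrm J},$$ and for $X,Y\in\mathscr P_{\mathrm J}$ write $X\preceq_{\mathrm J}Y$ if $\mathrm JY-\mathrm JX$ is positive semidefinite Hermitian. Then for all $A,B\in\mathscr P_{\mathrm J}$, all $t\in[0,1]$ and all real $r\ge 1$, $$A\,\sharp^{\mathrm J}_t B\preceq_{\mathrm J}\mathrm J\quad\Longrightarrow\quad A^r_{\mathrm J}\,\sharp^{\mathrm J}_t B^r_{\mathrm J}\preceq_{\mathrm J}\mathrm J.$$ -/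

import Mathlib

open scoped ComplexOrder Quaternion

/-- The order on the real quaternions analogous to the one on the complex numbers: `x ≤ y` iff
`y - x` is a nonnegative real number. In particular `0 < x` iff `x` is a positive real number. -/
instance quaternionPartialOrder : PartialOrder ℍ[ℝ] where
  le x y := x.re ≤ y.re ∧ x.imI = y.imI ∧ x.imJ = y.imJ ∧ x.imK = y.imK
  le_refl x := ⟨le_refl _, rfl, rfl, rfl⟩
  le_trans x y z h₁ h₂ :=
    ⟨h₁.1.trans h₂.1, h₁.2.1.trans h₂.2.1, h₁.2.2.1.trans h₂.2.2.1, h₁.2.2.2.trans h₂.2.2.2⟩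
  le_antisymm x y h₁ h₂ := by
    ext
    · exact le_antisymm h₁.1 h₂.1
    · exact h₁.2.1
    · exact h₁.2.2.1
    · exact h₁.2.2.2

namespace JCone

/-- Square matrices of size `p + q`, in block form `𝔻ᵖ ⊕ 𝔻^q`. -/
abbrev Mat (𝔻 : Type*) (p q : ℕ) : Type _ := Matrix (Fin p ⊕ Fin q) (Fin p ⊕ Fin q) 𝔻

/-- The signature matrix `J = diag(Id_p, -Id_q)`. -/
def sigJ (𝔻 : Type*) [Ring 𝔻] (p q : ℕ) : Mat 𝔻 p q := Matrix.fromBlocks 1 0 0 (-1)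

section

variable {𝔻 : Type*} [Ring 𝔻] {p q : ℕ}

/-- The `J`-product `X • Y = X J Y`. -/
def jMul (X Y : Mat 𝔻 p q) : Mat 𝔻 p q := X * sigJ 𝔻 p q * Y

/-- The space of `J`-Hermitian matrices: `J X* J = X`. -/
def jHermitian (𝔻 : Type*) [Ring 𝔻] [StarRing 𝔻] (p q : ℕ) : Set (Mat 𝔻 p q) :=
  {X | sigJ 𝔻 p q * X.conjTranspose * sigJ 𝔻 p q = X}

/-- The cone of `J`-positive matrices: the `J`-Hermitian `X` with `J X` positive definite. -/
def jPos (𝔻 : Type*) [Ring 𝔻] [StarRing 𝔻] [PartialOrder 𝔻] (p q : ℕ) : Set (Mat 𝔻 p q) :=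
  {X | X ∈ jHermitian 𝔻 p q ∧ (sigJ 𝔻 p q * X).PosDef}

/-- The `J`-Loewner order: `J Y - J X` is positive semidefinite. -/
def jLE [StarRing 𝔻] [PartialOrder 𝔻] (X Y : Mat 𝔻 p q) : Prop :=
  (sigJ 𝔻 p q * Y - sigJ 𝔻 p q * X).PosSemidef

variable [TopologicalSpace 𝔻] [IsTopologicalRing 𝔻]

/-- The `J`-exponential `exp_J(X) = J exp(J X)`. -/
noncomputable def jExp (X : Mat 𝔻 p q) : Mat 𝔻 p q :=
  sigJ 𝔻 p q * NormedSpace.exp (sigJ 𝔻 p q * X)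

/-- The `J`-logarithm: the inverse of `exp_J` restricted to the `J`-Hermitian matrices. -/
noncomputable def jLog [StarRing 𝔻] (X : Mat 𝔻 p q) : Mat 𝔻 p q :=
  Function.invFunOn jExp (jHermitian 𝔻 p q) X

/-- The power `X^t_J = exp_J(t log_J(X))`. -/
noncomputable def jPow [StarRing 𝔻] [Module ℝ 𝔻] (X : Mat 𝔻 p q) (t : ℝ) : Mat 𝔻 p q :=
  jExp (t • jLog X)

/-- The weighted `J`-geometric mean
`A^{1/2}_J • (A^{-1/2}_J • B • A^{-1/2}_J)^t_J • A^{1/2}_J`. -/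
noncomputable def jMean [StarRing 𝔻] [Module ℝ 𝔻] (t : ℝ) (A B : Mat 𝔻 p q) : Mat 𝔻 p q :=
  jMul (jMul (jPow A (1 / 2))
    (jPow (jMul (jMul (jPow A (-1 / 2)) B) (jPow A (-1 / 2))) t)) (jPow A (1 / 2))

end

end JCone

/-! Left multiplication by `J` turns the `J`-product, `exp_J`, `J`-powers, `J`-means and the
`J`-order into the ordinary ones, and `J` itself into `1`. The claim is thus the classical Ando–Hiai
inequality for `a = JA`, `b = JB`. A faithful star-representation by complex matrices places all
three coefficient rings in a C⋆-algebra (`jAndoHiai_of_starAlgHom`).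

There, write `a = y²` and `b = y c y` with `y = a^{1/2}`, so that `a ♯ₜ b = y c^t y`. The hypothesis
gives `a ≤ c^{-t}`. For `r = 1 + s` with `0 ≤ s ≤ 1`, one has `a^r = y a^s y` with `a^s ≤ c^{-st}`,
and `b^r ≤ y c^{1+s-st} y`. Covariance and monotonicity of the mean then bound `a^r ♯ₜ b^r` by `y
(c^{-st} ♯ₜ c^{1+s-st}) y = y c^t y ≤ 1`. Repeated doubling reaches every `r ≥ 1`. -/

section AndoHiai

variable {A : Type*} [CStarAlgebra A] [PartialOrder A] [StarOrderedRing A]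

/-! ### Geometric means and the Ando–Hiai inequality in a C⋆-algebra. -/

namespace CFC

/-- The weighted geometric mean `a ♯ₜ b` in a C⋆-algebra. -/
noncomputable def geomMean (t : ℝ) (a b : A) : A :=
  a ^ (1 / 2 : ℝ) * (a ^ (-1 / 2 : ℝ) * b * a ^ (-1 / 2 : ℝ)) ^ t * a ^ (1 / 2 : ℝ)

lemma star_rpow (a : A) (x : ℝ) : star (a ^ x) = a ^ x :=
  (IsSelfAdjoint.of_nonneg rpow_nonneg).star_eq

lemma rpow_mul_rpow {a : A} (ha : IsStrictlyPositive a) (x y : ℝ) :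
    a ^ x * a ^ y = a ^ (x + y) := (rpow_add ha.isUnit).symm

lemma rpow_rpow_of_pos {a : A} (ha : IsStrictlyPositive a) (x y : ℝ) :
    (a ^ x) ^ y = a ^ (x * y) := by
  rcases eq_or_ne x 0 with rfl | hx
  · rw [rpow_zero a ha.nonneg, one_rpow, zero_mul, rpow_zero a ha.nonneg]
  · exact rpow_rpow a x y hx ha

lemma _root_.IsStrictlyPositive.star_mul_mul {c : A} (hc : IsStrictlyPositive c) {y : A}
    (hy : IsUnit y) : IsStrictlyPositive (star y * c * y) :=
  ⟨star_left_conjugate_nonneg hc.nonneg y, (hy.star.mul hc.isUnit).mul hy⟩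

lemma rpow_star_mul_mul {u : A} (hu : u ∈ unitary A) {c : A} (hc : IsStrictlyPositive c) (t : ℝ) :
    (star u * c * u) ^ t = star u * c ^ t * u := by
  have hu' : IsUnit u := (Unitary.toUnits ⟨u, hu⟩).isUnit
  have hc' := hc.star_mul_mul hu'
  set φ := Unitary.conjStarAlgAut ℝ A (star ⟨u, hu⟩) with hφ
  have happ : ∀ x, φ x = star u * x * u := fun x => by
    simp [hφ, Unitary.conjStarAlgAut_apply]
  have hcont : Continuous φ := by
    rw [show (φ : A → A) = fun x => star u * x * u from funext happ]; fun_prop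
  rw [rpow_eq_cfc_real hc'.nonneg, rpow_eq_cfc_real hc.nonneg, ← happ, ← happ]
  -- The exponent may be negative; invertibility keeps `0` out of the spectrum.
  have hs : ContinuousOn (fun x : ℝ => x ^ t) (spectrum ℝ c) := by
    intro x hx
    have : x ≠ 0 := fun h => spectrum.zero_notMem ℝ hc.isUnit (h ▸ hx)
    exact (Real.continuousAt_rpow_const x t (.inl this)).continuousWithinAt
  exact (StarAlgHomClass.map_cfc φ _ c hs hcont (.of_nonneg hc.nonneg)
    (by rw [happ]; exact .of_nonneg hc'.nonneg)).symm

/-- Polar decomposition: `y (y* y)^{-1/2}` is unitary, and powers commute with unitary conjugation.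
Any invertible `y` may therefore replace the square root of the first argument; covariance and
symmetry of the mean follow. -/
lemma geomMean_star_mul {y c : A} (hy : IsUnit y) (hc : IsStrictlyPositive c) (t : ℝ) :
    geomMean t (star y * y) (star y * c * y) = star y * c ^ t * y := by
  set a := star y * y with ha'
  have ha : IsStrictlyPositive a := ⟨star_mul_self_nonneg y, hy.star.mul hy⟩
  set h := a ^ (1 / 2 : ℝ) with hh
  set h' := a ^ (-1 / 2 : ℝ) with hh'
  have hsq : h' * a * h' = 1 := by
    have : a ^ (-1 / 2 : ℝ) * a ^ (1 : ℝ) * a ^ (-1 / 2 : ℝ) = 1 := by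
      rw [rpow_mul_rpow ha, rpow_mul_rpow ha]
      norm_num [rpow_zero a ha.nonneg]
    rwa [rpow_one a ha.nonneg] at this
  have hinv : h' * h = 1 := by
    rw [hh', hh, rpow_mul_rpow ha]
    norm_num [rpow_zero a ha.nonneg]
  have hinv' : h * h' = 1 := by
    rw [hh', hh, rpow_mul_rpow ha]
    norm_num [rpow_zero a ha.nonneg]
  have hs : star h = h := star_rpow _ _
  have hs' : star h' = h' := star_rpow _ _
  have hu1 : star (y * h') * (y * h') = 1 := by
    rw [star_mul, hs', ← hsq, ha']; simp only [mul_assoc]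
  have hu : y * h' ∈ unitary A := by
    have : IsUnit (y * h') := hy.mul (ha.rpow a _).isUnit
    exact ⟨hu1, this.mul_right_cancel (by rw [mul_assoc, hu1, mul_one, one_mul])⟩
  have e : h' * (star y * c * y) * h' = star (y * h') * c * (y * h') := by
    rw [star_mul, hs']; simp only [mul_assoc]
  rw [geomMean, ← hh, ← hh', e, rpow_star_mul_mul hu hc, star_mul, hs']
  calc h * (h' * star y * c ^ t * (y * h')) * h
      = (h * h') * star y * c ^ t * y * (h' * h) := by simp only [mul_assoc]
    _ = _ := by rw [hinv, hinv', one_mul, mul_one]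

/-- A positive pair has the form `(y y, y c y)`, with `y = a^{1/2}` and
`c = a^{-1/2} b a^{-1/2}`. -/
lemma exists_eq_conj {a b : A} (ha : IsStrictlyPositive a) (hb : IsStrictlyPositive b) :
    ∃ y c : A, IsUnit y ∧ IsStrictlyPositive y ∧ IsStrictlyPositive c ∧ star y = y ∧ a = y * y ∧
      b = y * c * y := by
  have hy := ha.rpow a (1 / 2)
  have hy' := ha.rpow a (-1 / 2)
  have h1 : a ^ (1 / 2 : ℝ) * a ^ (-1 / 2 : ℝ) = 1 := by
    rw [rpow_mul_rpow ha]; norm_num [rpow_zero a ha.nonneg]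
  have h2 : a ^ (-1 / 2 : ℝ) * a ^ (1 / 2 : ℝ) = 1 := by
    rw [rpow_mul_rpow ha]; norm_num [rpow_zero a ha.nonneg]
  refine ⟨a ^ (1 / 2 : ℝ), a ^ (-1 / 2 : ℝ) * b * a ^ (-1 / 2 : ℝ), hy.isUnit, hy, ?_,
    star_rpow _ _, ?_, ?_⟩
  · simpa only [star_rpow] using hb.star_mul_mul hy'.isUnit
  · rw [rpow_mul_rpow ha]; norm_num [rpow_one a ha.nonneg]
  · calc b = 1 * b * 1 := by simp
      _ = _ := by rw [← h1]; nth_rw 2 [h1]; rw [← h2]; simp only [mul_assoc]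

lemma geomMean_mul_mul {y c : A} (hy : IsUnit y) (hs : star y = y) (hc : IsStrictlyPositive c)
    (t : ℝ) : geomMean t (y * y) (y * c * y) = y * c ^ t * y := by
  simpa only [hs] using geomMean_star_mul hy hc t

lemma geomMean_conj {a b z : A} (ha : IsStrictlyPositive a) (hb : IsStrictlyPositive b)
    (hz : IsUnit z) (t : ℝ) :
    geomMean t (star z * a * z) (star z * b * z) = star z * geomMean t a b * z := by
  obtain ⟨y, c, hy, -, hc, hs, rfl, rfl⟩ := exists_eq_conj ha hb
  rw [geomMean_mul_mul hy hs hc]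
  have := geomMean_star_mul (hy.mul hz) hc t
  simpa only [star_mul, hs, mul_assoc] using this

lemma geomMean_symm {a b : A} (ha : IsStrictlyPositive a) (hb : IsStrictlyPositive b) (t : ℝ) :
    geomMean t a b = geomMean (1 - t) b a := by
  obtain ⟨y, c, hy, -, hc, hs, rfl, rfl⟩ := exists_eq_conj ha hb
  rw [geomMean_mul_mul hy hs hc]
  have hd := hc.rpow c (1 / 2)
  -- With `z = c^{1/2} y`, `z* z = y c y` and `z* c⁻¹ z = y y`: the same pair, in the opposite
  -- order.
  have := geomMean_star_mul (hd.isUnit.mul hy) (hc.rpow c (-1)) (1 - t)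
  rw [rpow_rpow_of_pos hc] at this
  simp only [star_mul, hs, star_rpow] at this
  have e1 : y * c ^ (1 / 2 : ℝ) * (c ^ (1 / 2 : ℝ) * y) = y * c * y := by
    rw [mul_assoc, ← mul_assoc (c ^ (1 / 2 : ℝ)), rpow_mul_rpow hc, ← mul_assoc]
    norm_num [rpow_one c hc.nonneg]
  have e2 : ∀ x : ℝ, y * c ^ (1 / 2 : ℝ) * c ^ x * (c ^ (1 / 2 : ℝ) * y) =
      y * c ^ (x + 1) * y := fun x => by
    rw [← mul_assoc, mul_assoc y, mul_assoc y, rpow_mul_rpow hc, rpow_mul_rpow hc]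
    ring_nf
  rw [e1, e2, e2] at this
  norm_num [rpow_zero c hc.nonneg] at this
  exact this.symm

lemma geomMean_mono_right {a b b' : A} {t : ℝ} (ht : t ∈ Set.Icc (0 : ℝ) 1) (h : b ≤ b') :
    geomMean t a b ≤ geomMean t a b' := by
  have key : ∀ (x : ℝ) {u v : A}, u ≤ v → a ^ x * u * a ^ x ≤ a ^ x * v * a ^ x :=
    fun x u v huv => by simpa only [star_rpow] using star_left_conjugate_le_conjugate huv (a ^ x)
  exact key _ (rpow_le_rpow ht (key _ h))

lemma geomMean_mono_left {a a' b : A} {t : ℝ} (ht : t ∈ Set.Icc (0 : ℝ) 1)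
    (ha : IsStrictlyPositive a) (hb : IsStrictlyPositive b) (h : a ≤ a') :
    geomMean t a b ≤ geomMean t a' b := by
  rw [geomMean_symm ha hb, geomMean_symm (ha.of_le h) hb]
  exact geomMean_mono_right ⟨by linarith [ht.2], by linarith [ht.1]⟩ h

lemma geomMean_rpow_rpow {c : A} (hc : IsStrictlyPositive c) (t x y : ℝ) :
    geomMean t (c ^ x) (c ^ y) = c ^ ((1 - t) * x + t * y) := by
  have := geomMean_mul_mul (hc.rpow c (x / 2)).isUnit (star_rpow c (x / 2)) (hc.rpow c (y - x)) t
  simp only [rpow_mul_rpow hc, rpow_rpow_of_pos hc] at this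
  ring_nf at this ⊢
  exact this

/-- For `z = c^{t/2} y`, the C⋆-identity makes `z* z ≤ 1` equivalent to `z z* ≤ 1`; conjugating the
latter by `c^{-t/2}` isolates `y y`. -/
lemma le_rpow_neg_of_mul_rpow_mul_le_one {y c : A} (hs : star y = y)
    (hc : IsStrictlyPositive c) {t : ℝ} (h : y * c ^ t * y ≤ 1) : y * y ≤ c ^ (-t) := by
  have e : star (c ^ (t / 2) * y) * (c ^ (t / 2) * y) = y * c ^ t * y := by
    rw [star_mul, hs, star_rpow, mul_assoc, ← mul_assoc (c ^ (t / 2)), rpow_mul_rpow hc,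
      add_halves, ← mul_assoc]
  rw [← e, ← CStarAlgebra.norm_le_one_iff_of_nonneg _ (star_mul_self_nonneg _),
    CStarRing.norm_star_mul_self, ← CStarRing.norm_self_mul_star,
    CStarAlgebra.norm_le_one_iff_of_nonneg _ (mul_star_self_nonneg _)] at h
  have := star_left_conjugate_le_conjugate h (c ^ (-(t / 2)))
  rw [star_mul, hs, star_rpow, star_rpow, mul_one, rpow_mul_rpow hc] at this
  have e2 : c ^ (-(t / 2)) * (c ^ (t / 2) * y * (y * c ^ (t / 2))) * c ^ (-(t / 2)) = y * y := by
    calc _ = (c ^ (-(t / 2)) * c ^ (t / 2)) * (y * y) * (c ^ (t / 2) * c ^ (-(t / 2))) := by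
          simp only [mul_assoc]
      _ = _ := by rw [rpow_neg_mul_rpow _ hc, rpow_mul_rpow_neg _ hc, one_mul, mul_one]
  rw [e2] at this
  convert this using 2
  ring

/-- The restriction `s ≤ 1` keeps both `s` and `1 - s` in `[0, 1]`, where powers and means are
operator monotone. -/
lemma andoHiai_of_le_two {a b : A} (ha : IsStrictlyPositive a) (hb : IsStrictlyPositive b) {t : ℝ}
    (ht : t ∈ Set.Icc (0 : ℝ) 1) (h : geomMean t a b ≤ 1) {s : ℝ} (hs : s ∈ Set.Icc (0 : ℝ) 1) :
    geomMean t (a ^ (1 + s)) (b ^ (1 + s)) ≤ 1 := by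
  obtain ⟨y, c, hy, hyp, hc, hys, hay, hbc⟩ := exists_eq_conj ha hb
  rw [hay, hbc, geomMean_mul_mul hy hys hc] at h
  have hac : a ≤ c ^ (-t) := hay ▸ le_rpow_neg_of_mul_rpow_mul_le_one hys hc h
  have hbneg : y * b ^ (-1 : ℝ) * y = c ^ (-1 : ℝ) := by
    have h1 : y * b ^ (-1 : ℝ) * y * c = 1 := by
      refine hy.mul_right_cancel ?_
      have : b ^ (-1 : ℝ) * b = 1 := by
        simpa only [rpow_one b hb.nonneg] using rpow_neg_mul_rpow (1 : ℝ) hb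
      calc y * b ^ (-1 : ℝ) * y * c * y = y * (b ^ (-1 : ℝ) * (y * c * y)) := by
            simp only [mul_assoc]
        _ = 1 * y := by rw [← hbc, this, mul_one, one_mul]
    refine hc.isUnit.mul_right_cancel (h1.trans ?_)
    simpa only [rpow_one c hc.nonneg] using (rpow_neg_mul_rpow (1 : ℝ) hc).symm
  -- The left side is `a ♯_{1-s} c⁻¹`, since `y b⁻¹ y = c⁻¹`; then `a ≤ c^{-t}` enters by
  -- monotonicity.
  have hmid : y * b ^ (-(1 - s)) * y ≤ c ^ (-(s * t) - (1 - s)) := by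
    have e := geomMean_mul_mul hy hys (hb.rpow b (-1)) (1 - s)
    rw [hbneg, ← hay, rpow_rpow_of_pos hb, neg_one_mul] at e
    rw [← e]
    refine (geomMean_mono_left ⟨by linarith [hs.2], by linarith [hs.1]⟩ ha
      (hc.rpow c _) hac).trans_eq ?_
    rw [geomMean_rpow_rpow hc]
    congr 1; ring
  have hbr : b ^ (1 + s) ≤ y * c ^ (2 - s * t - (1 - s)) * y := by
    -- Split `b^{1+s} = b · b^{-(1-s)} · b` and expand the outer factors as `y c y`, so that the
    -- middle is the quantity just bounded.
    have e1 : b ^ (1 + s) = star (c * y) * (y * b ^ (-(1 - s)) * y) * (c * y) := by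
      have e : b ^ (1 + s) = b * b ^ (-(1 - s)) * b := by
        have := rpow_mul_rpow hb 1 (-(1 - s))
        rw [rpow_one b hb.nonneg] at this
        rw [this]
        have := rpow_mul_rpow hb (1 + -(1 - s)) 1
        rw [rpow_one b hb.nonneg] at this
        rw [this]; congr 1; ring
      rw [e, star_mul, hys, (IsSelfAdjoint.of_nonneg hc.nonneg).star_eq]
      nth_rw 1 [hbc]; nth_rw 2 [hbc]
      simp only [mul_assoc]
    have e2 : y * c ^ (2 - s * t - (1 - s)) * y =
        star (c * y) * c ^ (-(s * t) - (1 - s)) * (c * y) := by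
      have := rpow_mul_rpow hc 1 (-(s * t) - (1 - s))
      rw [rpow_one c hc.nonneg] at this
      have h2 := rpow_mul_rpow hc (1 + (-(s * t) - (1 - s))) 1
      rw [rpow_one c hc.nonneg, ← this] at h2
      rw [star_mul, hys, (IsSelfAdjoint.of_nonneg hc.nonneg).star_eq,
        show 2 - s * t - (1 - s) = 1 + (-(s * t) - (1 - s)) + 1 by ring, ← h2]
      simp only [mul_assoc]
    rw [e1, e2]
    exact star_left_conjugate_le_conjugate hmid _
  have har : a ^ (1 + s) = y * a ^ s * y := by
    have e : a = y ^ (2 : ℝ) := by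
      rw [hay, show (2 : ℝ) = 1 + 1 by norm_num, ← rpow_mul_rpow hyp, rpow_one y hyp.nonneg]
    have := rpow_mul_rpow hyp 1 (2 * s)
    rw [rpow_one y hyp.nonneg] at this
    have h2 := rpow_mul_rpow hyp (1 + 2 * s) 1
    rw [rpow_one y hyp.nonneg, ← this] at h2
    rw [e, rpow_rpow_of_pos hyp, rpow_rpow_of_pos hyp, h2]
    congr 1; ring
  have hcs := hc.rpow c (2 - s * t - (1 - s))
  have has := ha.rpow a s
  calc geomMean t (a ^ (1 + s)) (b ^ (1 + s))
      ≤ geomMean t (a ^ (1 + s)) (y * c ^ (2 - s * t - (1 - s)) * y) := geomMean_mono_right ht hbr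
    _ = y * geomMean t (a ^ s) (c ^ (2 - s * t - (1 - s))) * y := by
        rw [har]; simpa only [hys] using geomMean_conj has hcs hy t
    _ ≤ y * geomMean t (c ^ (-(s * t))) (c ^ (2 - s * t - (1 - s))) * y := by
        have : a ^ s ≤ c ^ (-(s * t)) := by
          have := rpow_le_rpow hs hac
          rwa [rpow_rpow_of_pos hc, show -t * s = -(s * t) by ring] at this
        simpa only [hys] using
          star_left_conjugate_le_conjugate (geomMean_mono_left ht has hcs this) y
    _ = y * c ^ t * y := by rw [geomMean_rpow_rpow hc]; congr 3; ring
    _ ≤ 1 := h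

/-- The **Ando–Hiai inequality** in a C⋆-algebra. -/
theorem andoHiai {a b : A} (ha : IsStrictlyPositive a) (hb : IsStrictlyPositive b) {t : ℝ}
    (ht : t ∈ Set.Icc (0 : ℝ) 1) (h : geomMean t a b ≤ 1) {r : ℝ} (hr : 1 ≤ r) :
    geomMean t (a ^ r) (b ^ r) ≤ 1 := by
  have key : ∀ n : ℕ, ∀ r : ℝ, 1 ≤ r → r ≤ 2 ^ n → geomMean t (a ^ r) (b ^ r) ≤ 1 := by
    intro n
    induction n with
    | zero =>
      intro r h1 h2
      obtain rfl : r = 1 := le_antisymm (by simpa using h2) h1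
      rwa [rpow_one a ha.nonneg, rpow_one b hb.nonneg]
    | succ n ih =>
      intro r h1 h2
      rcases le_total r 2 with hr2 | hr2
      · have := andoHiai_of_le_two ha hb ht h (s := r - 1) ⟨by linarith, by linarith⟩
        rwa [add_sub_cancel] at this
      -- The induction hypothesis at `r / 2` supplies the premise, and `s = 1` doubles the exponent.
      · have := andoHiai_of_le_two (ha.rpow a (r / 2)) (hb.rpow b (r / 2)) ht
          (ih (r / 2) (by linarith) (by rw [pow_succ] at h2; linarith)) (s := 1) (by simp)
        rw [rpow_rpow_of_pos ha, rpow_rpow_of_pos hb] at this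
        norm_num at this
        exact this
  obtain ⟨n, hn⟩ := pow_unbounded_of_one_lt r one_lt_two
  exact key n r hr hn.le

end CFC

end AndoHiai

/-! ### Transfer of the `J`-calculus along a faithful star-representation. -/

section Transfer

open scoped Matrix.Norms.L2Operator MatrixOrder
open NormedSpace

lemma CFC.exp_smul_log {A : Type*} [CStarAlgebra A] [PartialOrder A] [StarOrderedRing A] {a : A}
    (ha : IsStrictlyPositive a) (t : ℝ) : exp (t • log a) = a ^ t := by
  have hne : ∀ x ∈ spectrum ℝ a, x ≠ 0 := fun x hx h => spectrum.zero_notMem ℝ ha.isUnit (h ▸ hx)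
  have hpos : ∀ x ∈ spectrum ℝ a, 0 ≤ x := fun x hx => spectrum_nonneg_of_nonneg ha.nonneg hx
  have hc : ContinuousOn Real.log (spectrum ℝ a) :=
    fun x hx => (Real.continuousAt_log (hne x hx)).continuousWithinAt
  rw [log, ← cfc_smul t Real.log a hc, ← real_exp_eq_normedSpace_exp (cfc_predicate _ a),
    ← cfc_comp' Real.exp _ a (by fun_prop) (by fun_prop), rpow_eq_cfc_real ha.nonneg]
  refine cfc_congr fun x hx => ?_
  simp only [smul_eq_mul]
  rw [Real.rpow_def_of_pos ((hpos x hx).lt_of_ne' (hne x hx)), mul_comm]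

namespace JCone

section Algebra

variable {𝔻 : Type*} [Ring 𝔻] {p q : ℕ}

lemma sigJ_mul_self : sigJ 𝔻 p q * sigJ 𝔻 p q = 1 := by
  simp [sigJ, Matrix.fromBlocks_multiply]

lemma sigJ_mul_sigJ_mul (X : Mat 𝔻 p q) : sigJ 𝔻 p q * (sigJ 𝔻 p q * X) = X := by
  rw [← mul_assoc, sigJ_mul_self, one_mul]

lemma star_sigJ [StarRing 𝔻] : star (sigJ 𝔻 p q) = sigJ 𝔻 p q := by
  simp [sigJ, Matrix.star_eq_conjTranspose, Matrix.fromBlocks_conjTranspose]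

lemma mem_jHermitian_iff [StarRing 𝔻] {X : Mat 𝔻 p q} :
    X ∈ jHermitian 𝔻 p q ↔ IsSelfAdjoint (sigJ 𝔻 p q * X) := by
  rw [jHermitian, Set.mem_ofPred_eq, IsSelfAdjoint, star_mul, star_sigJ, mul_assoc,
    Matrix.star_eq_conjTranspose]
  constructor <;> intro h
  · rw [← h, sigJ_mul_sigJ_mul, h]
  · rw [h, sigJ_mul_sigJ_mul]

lemma sigJ_mul_jMul (X Y : Mat 𝔻 p q) :
    sigJ 𝔻 p q * jMul X Y = (sigJ 𝔻 p q * X) * (sigJ 𝔻 p q * Y) := by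
  simp only [jMul, mul_assoc]

end Algebra

variable {𝔻 : Type*} [NormedRing 𝔻] [StarRing 𝔻] [NormedAlgebra ℝ 𝔻] [FiniteDimensional ℝ 𝔻]
  {p q : ℕ} {m : Type*} [Fintype m] [DecidableEq m] (φ : Mat 𝔻 p q →⋆ₐ[ℝ] Matrix m m ℂ)

lemma continuous_starAlgHom : Continuous φ :=
  LinearMap.continuous_of_finiteDimensional φ.toAlgHom.toLinearMap

lemma map_exp_starAlgHom (X : Mat 𝔻 p q) : φ (exp X) = exp (φ X) := by
  have : CompleteSpace 𝔻 := FiniteDimensional.complete ℝ 𝔻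
  -- The exponential depends only on the topology, so any submultiplicative norm inducing it will
  -- do.
  let : NormedRing (Mat 𝔻 p q) := Matrix.linftyOpNormedRing
  let : NormedAlgebra ℝ (Mat 𝔻 p q) := Matrix.linftyOpNormedAlgebra
  let : NormedAlgebra ℚ (Mat 𝔻 p q) := .restrictScalars ℚ ℝ _
  let : Algebra ℚ (Matrix m m ℂ) := inferInstance
  exact map_exp φ (continuous_starAlgHom φ) X

variable {φ}

lemma jExp_injOn (hφ : Function.Injective φ) :
    Set.InjOn (jExp (p := p) (q := q)) (jHermitian 𝔻 p q) := by
  intro X hX Y hY h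
  have h1 := congrArg (fun Z => φ (sigJ 𝔻 p q * Z)) h
  simp only [jExp, sigJ_mul_sigJ_mul, map_exp_starAlgHom] at h1
  have h2 := congrArg CFC.log h1
  rw [CFC.log_exp _ ((mem_jHermitian_iff.1 hX).map φ),
    CFC.log_exp _ ((mem_jHermitian_iff.1 hY).map φ)] at h2
  rw [← sigJ_mul_sigJ_mul X, hφ h2, sigJ_mul_sigJ_mul]

/-- The range of `φ` is a finite-dimensional, hence closed, real star-subalgebra, so it is stable
under continuous functional calculus. The logarithm taken among complex matrices therefore comes
back to `𝔻`. -/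
lemma exists_jExp_eq (hφ : Function.Injective φ) {X : Mat 𝔻 p q}
    (hX : IsStrictlyPositive (φ (sigJ 𝔻 p q * X))) :
    ∃ Y ∈ jHermitian 𝔻 p q, jExp Y = X ∧
      φ (sigJ 𝔻 p q * Y) = CFC.log (φ (sigJ 𝔻 p q * X)) := by
  have hcl : IsClosed (φ.range : Set (Matrix m m ℂ)) :=
    Submodule.closed_of_finiteDimensional φ.toAlgHom.toLinearMap.range
  obtain ⟨Z, hZ⟩ : CFC.log (φ (sigJ 𝔻 p q * X)) ∈ φ.range :=
    cfc_mem Real.log ⟨_, rfl⟩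
  have hZ' : φ Z = CFC.log (φ (sigJ 𝔻 p q * X)) := hZ
  refine ⟨sigJ 𝔻 p q * Z, mem_jHermitian_iff.2 ?_, ?_, ?_⟩
  · rw [sigJ_mul_sigJ_mul, IsSelfAdjoint]
    apply hφ
    rw [map_star, hZ', IsSelfAdjoint.log.star_eq]
  · rw [jExp, sigJ_mul_sigJ_mul]
    have : exp Z = sigJ 𝔻 p q * X := hφ (by rw [map_exp_starAlgHom, hZ', CFC.exp_log _ hX])
    rw [this, sigJ_mul_sigJ_mul]
  · rw [sigJ_mul_sigJ_mul, hZ']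

lemma map_jPow (hφ : Function.Injective φ) {X : Mat 𝔻 p q}
    (hX : IsStrictlyPositive (φ (sigJ 𝔻 p q * X))) (t : ℝ) :
    φ (sigJ 𝔻 p q * jPow X t) = φ (sigJ 𝔻 p q * X) ^ t := by
  obtain ⟨Y, hY, hYX, hlog⟩ := exists_jExp_eq hφ hX
  have : jLog X = Y := by
    rw [← hYX]; exact (jExp_injOn hφ).leftInvOn_invFunOn hY
  rw [jPow, jExp, sigJ_mul_sigJ_mul, map_exp_starAlgHom, this, Matrix.mul_smul, map_smul, hlog,
    CFC.exp_smul_log hX]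

lemma map_jMean (hφ : Function.Injective φ) {X Y : Mat 𝔻 p q}
    (hX : IsStrictlyPositive (φ (sigJ 𝔻 p q * X))) (hY : IsStrictlyPositive (φ (sigJ 𝔻 p q * Y)))
    (t : ℝ) : φ (sigJ 𝔻 p q * jMean t X Y) =
      CFC.geomMean t (φ (sigJ 𝔻 p q * X)) (φ (sigJ 𝔻 p q * Y)) := by
  have e : φ (sigJ 𝔻 p q * jMul (jMul (jPow X (-1 / 2)) Y) (jPow X (-1 / 2))) =
      φ (sigJ 𝔻 p q * X) ^ (-1 / 2 : ℝ) * φ (sigJ 𝔻 p q * Y) *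
        φ (sigJ 𝔻 p q * X) ^ (-1 / 2 : ℝ) := by
    simp only [sigJ_mul_jMul, map_mul φ (sigJ 𝔻 p q * _) _, map_mul φ (_ * _ * _) _, map_jPow hφ hX]
  have hpos : IsStrictlyPositive
      (φ (sigJ 𝔻 p q * jMul (jMul (jPow X (-1 / 2)) Y) (jPow X (-1 / 2)))) := by
    rw [e]
    simpa only [CFC.star_rpow] using hY.star_mul_mul (hX.rpow _ (-1 / 2)).isUnit
  rw [jMean, sigJ_mul_jMul, map_mul, sigJ_mul_jMul, map_mul, map_jPow hφ hX, map_jPow hφ hpos, e]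
  rfl

/-- The `J`-Ando–Hiai inequality over a coefficient ring whose matrix algebra has a faithful
representation by complex matrices that preserves and reflects positivity. -/
theorem jAndoHiai_of_starAlgHom [PartialOrder 𝔻] (hφ : Function.Injective φ)
    (hpos : ∀ X, X.PosDef → (φ X).PosDef) (hpsd : ∀ X, X.PosSemidef ↔ (φ X).PosSemidef)
    {t : ℝ} (ht : t ∈ Set.Icc (0 : ℝ) 1) {r : ℝ} (hr : 1 ≤ r) {A B : Mat 𝔻 p q}
    (hA : A ∈ jPos 𝔻 p q) (hB : B ∈ jPos 𝔻 p q) (h : jLE (jMean t A B) (sigJ 𝔻 p q)) :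
    jLE (jMean t (jPow A r) (jPow B r)) (sigJ 𝔻 p q) := by
  have hA' := (hpos _ hA.2).isStrictlyPositive
  have hB' := (hpos _ hB.2).isStrictlyPositive
  have hle : ∀ X : Mat 𝔻 p q, jLE X (sigJ 𝔻 p q) ↔ φ (sigJ 𝔻 p q * X) ≤ 1 := fun X => by
    rw [jLE, hpsd, map_sub, sigJ_mul_self, map_one, Matrix.le_iff]
  have hAr := hA'.rpow _ r
  have hBr := hB'.rpow _ r
  rw [← map_jPow hφ hA'] at hAr
  rw [← map_jPow hφ hB'] at hBr
  rw [hle, map_jMean hφ hA' hB'] at h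
  rw [hle, map_jMean hφ hAr hBr, map_jPow hφ hA', map_jPow hφ hB']
  exact CFC.andoHiai hA' hB' ht h hr

end JCone

end Transfer

/-! ### Complex representations of real and quaternionic matrices. -/

section Representations

open scoped Matrix MatrixOrder

/-- A real matrix is positive semidefinite iff it is so as a complex matrix. -/
lemma Matrix.posSemidef_map_ofReal_iff {n : Type*} [Fintype n] [DecidableEq n] {X : Matrix n n ℝ} :
    X.PosSemidef ↔ (X.map ((↑) : ℝ → ℂ)).PosSemidef := by
  have hmap : (X.map ((↑) : ℝ → ℂ))ᴴ = Xᴴ.map ((↑) : ℝ → ℂ) := by ext; simp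
  constructor
  · intro h
    -- Factoring as `Yᴴ Y` avoids splitting complex test vectors; the converse only needs real ones.
    obtain ⟨Y, rfl⟩ := CStarAlgebra.nonneg_iff_eq_star_mul_self.1 (Matrix.nonneg_iff_posSemidef.2 h)
    rw [Matrix.star_eq_conjTranspose]
    have : (Yᴴ * Y).map ((↑) : ℝ → ℂ) =
        (Y.map ((↑) : ℝ → ℂ))ᴴ * Y.map ((↑) : ℝ → ℂ) := by
      ext; simp [Matrix.mul_apply]
    rw [this]
    exact Matrix.posSemidef_conjTranspose_mul_self _
  · intro h
    refine .of_dotProduct_mulVec_nonneg ?_ fun x => ?_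
    · refine Matrix.map_injective Complex.ofReal_injective ?_
      exact hmap.symm.trans h.1
    · have := h.dotProduct_mulVec_nonneg (fun i => (x i : ℂ))
      rw [← Complex.zero_le_real]
      convert this using 1
      simp [dotProduct, Matrix.mulVec]

namespace JCone

variable (n : Type*) [Fintype n] [DecidableEq n]

/-- Real matrices as complex matrices. -/
noncomputable def realRep : Matrix n n ℝ →⋆ₐ[ℝ] Matrix n n ℂ where
  __ := Complex.ofRealAm.mapMatrix (m := n)
  map_star' X := by ext; simp [Matrix.star_apply]

/-- The quaternions as complex `2 × 2` matrices. -/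
noncomputable def quaternionRep : ℍ[ℝ] →⋆ₐ[ℝ] Matrix (Fin 2) (Fin 2) ℂ where
  toFun x := !![⟨x.re, x.imI⟩, ⟨x.imJ, x.imK⟩; ⟨-x.imJ, x.imK⟩, ⟨x.re, -x.imI⟩]
  map_one' := by
    ext i j; fin_cases i <;> fin_cases j <;> simp [Complex.ext_iff]
  map_mul' x y := by
    ext i j; fin_cases i <;> fin_cases j <;> simp [Complex.ext_iff, Matrix.mul_apply] <;>
      constructor <;> ring
  map_zero' := by
    ext i j; fin_cases i <;> fin_cases j <;> simp [Complex.ext_iff]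
  map_add' x y := by
    ext i j; fin_cases i <;> fin_cases j <;> simp [Complex.ext_iff] <;> ring
  commutes' r := by
    ext i j; fin_cases i <;> fin_cases j <;>
      simp [Complex.ext_iff, Matrix.algebraMap_matrix_apply]
  map_star' x := by
    ext i j; fin_cases i <;> fin_cases j <;> simp [Complex.ext_iff, Matrix.star_apply]

lemma quaternionRep_apply (x : ℍ[ℝ]) : quaternionRep x =
    !![⟨x.re, x.imI⟩, ⟨x.imJ, x.imK⟩; ⟨-x.imJ, x.imK⟩, ⟨x.re, -x.imI⟩] := rfl

/-- Quaternionic matrices as complex matrices of twice the size. -/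
noncomputable def quaternionMatrixRep : Matrix n n ℍ[ℝ] →⋆ₐ[ℝ] Matrix (n × Fin 2) (n × Fin 2) ℂ where
  __ := (Matrix.compAlgEquiv n (Fin 2) ℂ ℝ).toAlgHom.comp (quaternionRep.toAlgHom.mapMatrix (m := n))
  map_star' X := by
    ext ⟨i, a⟩ ⟨j, b⟩
    have := congrFun (congrFun (map_star quaternionRep (X j i)) a) b
    simpa [Matrix.star_apply] using this

variable {n}

lemma quaternionMatrixRep_apply (X : Matrix n n ℍ[ℝ]) (i j : n) (a b : Fin 2) :
    quaternionMatrixRep n X (i, a) (j, b) = quaternionRep (X i j) a b := rfl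

lemma quaternionMatrixRep_injective : Function.Injective (quaternionMatrixRep n) := by
  intro X Y h
  ext i j
  all_goals
    have h0 := congrFun (congrFun h (i, 0)) (j, 0)
    have h1 := congrFun (congrFun h (i, 0)) (j, 1)
    simp only [quaternionMatrixRep_apply, quaternionRep_apply] at h0 h1
    simp [Complex.ext_iff] at h0 h1
    tauto

/-- The complex coordinates of a quaternionic vector. -/
def quaternionVec {ι : Type*} : (ι → ℍ[ℝ]) ≃ (ι × Fin 2 → ℂ) where
  toFun w i := ![⟨(w i.1).re, (w i.1).imI⟩, ⟨-(w i.1).imJ, (w i.1).imK⟩] i.2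
  invFun z i := ⟨(z (i, 0)).re, (z (i, 0)).im, -(z (i, 1)).re, (z (i, 1)).im⟩
  left_inv w := by ext <;> simp
  right_inv z := by
    ext ⟨i, a⟩
    fin_cases a <;> simp

lemma quaternionVec_apply_zero {ι : Type*} (w : ι → ℍ[ℝ]) (i : ι) :
    quaternionVec w (i, 0) = ⟨(w i).re, (w i).imI⟩ := rfl

lemma quaternionVec_apply_one {ι : Type*} (w : ι → ℍ[ℝ]) (i : ι) :
    quaternionVec w (i, 1) = ⟨-(w i).imJ, (w i).imK⟩ := rfl

/-- `quaternionVec w` stacks the first columns of `quaternionRep (w i)`, so the complex quadratic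
form is the top-left entry of the representation of `w* X w`. For Hermitian `X` that quaternion is
real and this entry determines it, so positivity carries over. -/
lemma dotProduct_quaternionMatrixRep (X : Matrix n n ℍ[ℝ]) (w : n → ℍ[ℝ]) :
    star (quaternionVec w) ⬝ᵥ (quaternionMatrixRep n X).mulVec (quaternionVec w) =
      ⟨(star w ⬝ᵥ X.mulVec w).re, (star w ⬝ᵥ X.mulVec w).imI⟩ := by
  let L : ℍ[ℝ] →+ ℂ :=
    { toFun := fun x => ⟨x.re, x.imI⟩
      map_zero' := rfl
      map_add' := fun _ _ => rfl }
  change _ = L (star w ⬝ᵥ X.mulVec w)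
  simp only [dotProduct, Matrix.mulVec, Fintype.sum_prod_type, Finset.mul_sum, map_sum,
    Fin.sum_univ_two, quaternionMatrixRep_apply, ← Finset.sum_add_distrib]
  refine Finset.sum_congr rfl fun i _ => Finset.sum_congr rfl fun j _ => ?_
  change _ = (⟨_, _⟩ : ℂ)
  simp [quaternionVec_apply_zero, quaternionVec_apply_one, quaternionRep_apply, Complex.ext_iff]
  constructor <;> ring

lemma quaternion_nonneg_iff {x : ℍ[ℝ]} (hx : star x = x) : 0 ≤ x ↔ 0 ≤ x.re := by
  have h := QuaternionAlgebra.ext_iff.1 hx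
  simp at h
  refine ⟨fun h => h.1, fun h' => ⟨h', ?_, ?_, ?_⟩⟩ <;> simp <;> linarith

lemma star_dotProduct_mulVec_self {ι R : Type*} [Fintype ι] [Ring R] [StarRing R]
    {X : Matrix ι ι R} (hX : X.IsHermitian) (w : ι → R) :
    star (star w ⬝ᵥ X.mulVec w) = star w ⬝ᵥ X.mulVec w := by
  rw [← Matrix.star_dotProduct, Matrix.star_mulVec, hX.eq, Matrix.dotProduct_mulVec]

lemma quaternionMatrixRep_isHermitian {X : Matrix n n ℍ[ℝ]} :
    (quaternionMatrixRep n X).IsHermitian ↔ X.IsHermitian := by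
  change star _ = _ ↔ star _ = _
  rw [← map_star, quaternionMatrixRep_injective.eq_iff]

lemma posSemidef_quaternionMatrixRep_iff {X : Matrix n n ℍ[ℝ]} :
    X.PosSemidef ↔ (quaternionMatrixRep n X).PosSemidef := by
  rw [Matrix.posSemidef_iff_dotProduct_mulVec, Matrix.posSemidef_iff_dotProduct_mulVec,
    quaternionMatrixRep_isHermitian, ← quaternionVec.forall_congr_right]
  refine and_congr_right fun hX => forall_congr' fun w => ?_
  have hs := star_dotProduct_mulVec_self hX w
  rw [dotProduct_quaternionMatrixRep, quaternion_nonneg_iff hs, Complex.le_def]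
  have h := QuaternionAlgebra.ext_iff.1 hs
  simp at h ⊢
  intro; linarith

lemma posDef_quaternionMatrixRep {X : Matrix n n ℍ[ℝ]} (hX : X.PosDef) :
    (quaternionMatrixRep n X).PosDef := by
  rw [Matrix.posDef_iff_dotProduct_mulVec] at hX ⊢
  refine ⟨quaternionMatrixRep_isHermitian.2 hX.1, fun z hz => ?_⟩
  obtain ⟨w, rfl⟩ := quaternionVec.surjective z
  have hw : w ≠ 0 := by
    rintro rfl
    refine hz (funext fun ⟨i, a⟩ => ?_)
    fin_cases a <;> simp [quaternionVec_apply_zero, quaternionVec_apply_one, Complex.ext_iff]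
  have h := hX.2 hw
  have hs := QuaternionAlgebra.ext_iff.1 (star_dotProduct_mulVec_self hX.1 w)
  have hre : (star w ⬝ᵥ X.mulVec w).re ≠ 0 := by
    intro h0
    refine h.ne' ?_
    simp at hs
    ext <;> simp <;> linarith
  rw [dotProduct_quaternionMatrixRep, Complex.lt_def]
  simp at hs ⊢
  exact ⟨lt_of_le_of_ne h.le.1 hre.symm, by linarith⟩

end JCone

end Representations

theorem mainTheorem3 (p q : ℕ) (t : ℝ) (ht : t ∈ Set.Icc (0 : ℝ) 1) (r : ℝ) (hr : 1 ≤ r) :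
    (∀ A ∈ JCone.jPos ℝ p q, ∀ B ∈ JCone.jPos ℝ p q,
      JCone.jLE (JCone.jMean t A B) (JCone.sigJ ℝ p q) →
        JCone.jLE (JCone.jMean t (JCone.jPow A r) (JCone.jPow B r)) (JCone.sigJ ℝ p q)) ∧
    (∀ A ∈ JCone.jPos ℂ p q, ∀ B ∈ JCone.jPos ℂ p q,
      JCone.jLE (JCone.jMean t A B) (JCone.sigJ ℂ p q) →
        JCone.jLE (JCone.jMean t (JCone.jPow A r) (JCone.jPow B r)) (JCone.sigJ ℂ p q)) ∧
    (∀ A ∈ JCone.jPos ℍ[ℝ] p q, ∀ B ∈ JCone.jPos ℍ[ℝ] p q,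
      JCone.jLE (JCone.jMean t A B) (JCone.sigJ ℍ[ℝ] p q) →
        JCone.jLE (JCone.jMean t (JCone.jPow A r) (JCone.jPow B r)) (JCone.sigJ ℍ[ℝ] p q)) := by
  refine ⟨fun A hA B hB h => ?_, fun A hA B hB h => ?_, fun A hA B hB h => ?_⟩
  · have hinj : Function.Injective (JCone.realRep (Fin p ⊕ Fin q)) :=
      Matrix.map_injective Complex.ofReal_injective
    refine JCone.jAndoHiai_of_starAlgHom hinj (fun X hX => ?_)
      -- Definiteness of the complexification is semidefiniteness plus invertibility, and both
      -- survive the embedding.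
      (fun X => Matrix.posSemidef_map_ofReal_iff) ht hr hA hB h
    exact (Matrix.posSemidef_map_ofReal_iff.1 hX.posSemidef).posDef_iff_isUnit.2
      (hX.isUnit.map (JCone.realRep (Fin p ⊕ Fin q)))
  · exact JCone.jAndoHiai_of_starAlgHom (φ := StarAlgHom.id ℝ (JCone.Mat ℂ p q))
      Function.injective_id (fun _ hX => hX) (fun _ => Iff.rfl) ht hr hA hB h
  · exact JCone.jAndoHiai_of_starAlgHom JCone.quaternionMatrixRep_injective
      (fun _ => JCone.posDef_quaternionMatrixRep)
      (fun _ => JCone.posSemidef_quaternionMatrixRep_iff) ht hr hA hB h
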